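/- Consider a finite two-player zero-sum extensive-form game, possibly with chance moves and imperfect information, in which both players have perfect recall. For a player $i$ let $\mathcal S_i$ be the set of its information states, $\mathcal A(s)$ the nonempty finite set of actions available at $s\in\mathcal S_i$, $|\mathcal A_i|=\max_{s\in\mathcal S_i}|\mathcal A(s)|$ (and $0$ if $\mathcal S_i=\emptyset$), $u_i$ its utility on the set $\mathcal Z$ of terminal histories, and $\Delta_{u_i}=\max_{z,z'\in\mathcal Z}(u_i(z)-u_i(z'))$. A policy $\pi_i$ assigns to each $s\in\mathcal S_i$ a probability distribution on $\mathcal A(s)$; $v_i(\pi)$ is the expected utility of player $i$ under the joint policy $\pi=(\pi_i,\pi_{-i})$. For a joint policy $\pi$, the counterfactual values and regrets of player $i$ are $$q^c_{i,\pi}(s,a)=\sum_{h\in s}\eta_{-i,\pi}(h)\,q_{i,\pi}(h,a),\qquad r_{i,\pi}(s,a)=q^c_{i,\pi}(s,a)-\sum_{b\in\mathcal A(s)}\pi_i(s,b)\,q^c_{i,\pi}(s,b),$$ where $q_{i,\pi}(h,a)$ is the expected utility of player $i$ when $\pi$ is followed after the history $ha$, and $\eta_{-i,\pi}(h)$ is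 the contribution of the opponent and chance to the probability of reaching $h$. Player $i$ plays $T\ge 1$ iterations of CFR-BR if the joint policies $\pi^t=(\pi_i^t,b^t)$, $t=1,\dots,T$, satisfy the following: $b^t$ is a best response of the opponent to $\pi_i^t$; and $\pi_i^t$ is given by regret matching, that is, with $R^{t}(s,a)=\sum_{k=1}^{t-1}r_{i,\pi^k}(s,a)$ and $x^+=\max(x,0)$, $$\pi_i^t(s,a)=\frac{R^{t}(s,a)^+}{\sum_{b\in\mathcal A(s)}R^{t}(s,b)^+}$$ at every $s\in\mathcal S_i$ where the denominator is positive, while $\pi_i^t(s,\cdot)$ is an arbitrary distribution (for instance the uniform one) where it is $0$. Then, with $$\epsilon=\frac{\Delta_{u_i}\,|\mathcal S_i|\,\sqrt{|\mathcal A_i|}}{\sqrt T},$$ at least one of the iterates $\pi_i^1,\dots,\pi_i^T$ is player $i$'s part of a $2\epsilon$-Nash equilibrium, i.e. of a joint policy from which neither player can gain more than $2\epsilon$ by changing its own policy. Moreover, this holds for every best iterate, that is, for every $\pi_i^t$ whose value $v_i(\pi_i^t,b^t)$ against the opponent's best response is the largest among $t=1,\dots,T$. -/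

import Mathlib

/-- A node of a two-player extensive-form game: a terminal node with a payoff for each player,
a chance node with a fixed distribution over its actions, or a decision node of player `i` at
the information state `s`. `S i` is the type of information states of player `i`. -/
inductive EFNode (A : Type*) (S : Fin 2 → Type*) where
  | terminal (u : Fin 2 → ℝ)
  | chance (acts : Finset A) (p : stdSimplex ℝ acts)
  | decision (i : Fin 2) (s : S i)

/-- A finite two-player extensive-form game with chance and imperfect information.
Histories are finite sequences of actions. -/
structure EFGame (A : Type*) (S : Fin 2 → Type*) where
  /-- the actions available at each information state -/
  actions : (i : Fin 2) → S i → Finset A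
  /-- what happens at a history (irrelevant off `histories`) -/
  node : List A → EFNode A S
  /-- the histories of the game -/
  histories : Finset (List A)
  actions_nonempty : ∀ i s, (actions i s).Nonempty
  nil_mem : [] ∈ histories
  /-- `ha` is a history exactly if `h` is one and `a` is available there -/
  append_mem : ∀ h a, h ++ [a] ∈ histories ↔ h ∈ histories ∧
    match node h with
    | .terminal _ => False
    | .chance acts _ => a ∈ acts
    | .decision i s => a ∈ actions i s
  /-- every information state is a nonempty set of histories -/
  state_nonempty : ∀ i s, ∃ h ∈ histories, node h = .decision i s

namespace EFGame

variable {A : Type*} {S : Fin 2 → Type*}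

open Classical in
/-- The set of terminal histories. -/
noncomputable def terminals (G : EFGame A S) : Finset (List A) :=
  G.histories.filter fun h => ∃ u, G.node h = .terminal u

open Classical in
/-- The histories that make up the information state `s` of player `i`. -/
noncomputable def stateHistories (G : EFGame A S) (i : Fin 2) (s : S i) : Finset (List A) :=
  G.histories.filter fun h => G.node h = .decision i s

/-- The utility of player `i` at a terminal history. -/
def utility (G : EFGame A S) (i : Fin 2) (z : List A) : ℝ :=
  match G.node z with
  | .terminal u => u i
  | _ => 0

def IsZeroSum (G : EFGame A S) : Prop :=
  ∀ z ∈ G.terminals, G.utility 0 z + G.utility 1 z = 0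

/-- The experience of player `i` while the actions `l` are played from the history `h`:
the sequence of its own information states, each with the action taken there. -/
def experienceFrom (G : EFGame A S) (i : Fin 2) :
    List A → List A → List ((Σ j, S j) × A)
  | _, [] => []
  | h, a :: l =>
    match G.node h with
    | .decision j s =>
      if j = i then (⟨j, s⟩, a) :: G.experienceFrom i (h ++ [a]) l
      else G.experienceFrom i (h ++ [a]) l
    | _ => G.experienceFrom i (h ++ [a]) l

/-- Perfect recall: histories in the same information state of a player agree on everything
that this player has seen and done before. -/
def PerfectRecall (G : EFGame A S) : Prop :=
  ∀ (i : Fin 2) (s : S i), ∀ h ∈ G.stateHistories i s, ∀ h' ∈ G.stateHistories i s,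
    G.experienceFrom i [] h = G.experienceFrom i [] h'

/-- A (behavioural) policy of player `i`: a distribution over the available actions at each of
its information states. -/
abbrev Policy (G : EFGame A S) (i : Fin 2) : Type _ :=
  (s : S i) → stdSimplex ℝ (G.actions i s)

/-- A joint policy. -/
abbrev JointPolicy (G : EFGame A S) : Type _ := (i : Fin 2) → G.Policy i

open Classical in
/-- The probability of taking `a` at `h` under the joint policy `π`. -/
noncomputable def stepProb (G : EFGame A S) (π : G.JointPolicy) (h : List A) (a : A) : ℝ :=
  match G.node h with
  | .terminal _ => 0
  | .chance acts p => if ha : a ∈ acts then p.1 ⟨a, ha⟩ else 0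
  | .decision i s => if ha : a ∈ G.actions i s then (π i s).1 ⟨a, ha⟩ else 0

/-- The contribution of everyone but player `i` (chance included) to `stepProb`. -/
noncomputable def othersStepProb (G : EFGame A S) (i : Fin 2) (π : G.JointPolicy)
    (h : List A) (a : A) : ℝ :=
  match G.node h with
  | .decision j _ => if j = i then 1 else G.stepProb π h a
  | _ => G.stepProb π h a

/-- The product of the factors `w` along the actions `l` played from the history `h`. -/
def prodFrom (w : List A → A → ℝ) : List A → List A → ℝ
  | _, [] => 1
  | h, a :: l => w h a * prodFrom w (h ++ [a]) l

/-- The probability of reaching `h` under `π`. -/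
noncomputable def reach (G : EFGame A S) (π : G.JointPolicy) (h : List A) : ℝ :=
  prodFrom (G.stepProb π) [] h

/-- The contribution of everyone but player `i` (chance included) to the probability of
reaching `h` under `π`. -/
noncomputable def othersReach (G : EFGame A S) (i : Fin 2) (π : G.JointPolicy)
    (h : List A) : ℝ :=
  prodFrom (G.othersStepProb i π) [] h

/-- The expected utility of player `i` under `π`. -/
noncomputable def value (G : EFGame A S) (i : Fin 2) (π : G.JointPolicy) : ℝ :=
  ∑ z ∈ G.terminals, G.reach π z * G.utility i z

open Classical in
/-- The expected utility of player `i` when `π` is followed after the history `ha`. -/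
noncomputable def histActionValue (G : EFGame A S) (i : Fin 2) (π : G.JointPolicy)
    (h : List A) (a : A) : ℝ :=
  ∑ z ∈ G.terminals.filter (fun z => h ++ [a] <+: z),
    prodFrom (G.stepProb π) (h ++ [a]) (z.drop (h ++ [a]).length) * G.utility i z

/-- The counterfactual value of the action `a` at the information state `s` of player `i`. -/
noncomputable def cfActionValue (G : EFGame A S) (i : Fin 2) (π : G.JointPolicy)
    (s : S i) (a : G.actions i s) : ℝ :=
  ∑ h ∈ G.stateHistories i s, G.othersReach i π h * G.histActionValue i π h a

/-- The counterfactual value of the information state `s` of player `i`. -/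
noncomputable def cfValue (G : EFGame A S) (i : Fin 2) (π : G.JointPolicy) (s : S i) : ℝ :=
  ∑ a, (π i s).1 a * G.cfActionValue i π s a

/-- The instantaneous counterfactual regret. -/
noncomputable def cfRegret (G : EFGame A S) (i : Fin 2) (π : G.JointPolicy)
    (s : S i) (a : G.actions i s) : ℝ :=
  G.cfActionValue i π s a - G.cfValue i π s

/-- The counterfactual regret accumulated over the iterations `1, …, t - 1`. -/
noncomputable def cumRegret (G : EFGame A S) (i : Fin 2) (π : ℕ → G.JointPolicy) (t : ℕ)
    (s : S i) (a : G.actions i s) : ℝ :=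
  ∑ k ∈ Finset.Ico 1 t, G.cfRegret i (π k) s a

/-- In `π`, the policy of player `j` is a best response to the policies of the others. -/
def IsBestResponse (G : EFGame A S) (j : Fin 2) (π : G.JointPolicy) : Prop :=
  ∀ β : G.Policy j, G.value j (Function.update π j β) ≤ G.value j π

/-- `π 1, …, π T` are the joint policies of `T` iterations of CFR-BR in which player `i` is the
CFR player: on each iteration the opponent best-responds to the current policy of player `i`,
and the current policy of player `i` is obtained at each information state by regret matching on
the counterfactual regrets accumulated so far. Where no accumulated regret is positive, regret
matching leaves the distribution free (the uniform one is a common choice). -/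
structure IsCFRBR (G : EFGame A S) (i : Fin 2) (T : ℕ) (π : ℕ → G.JointPolicy) : Prop where
  bestResponse : ∀ t ∈ Finset.Icc 1 T, ∀ j, j ≠ i → G.IsBestResponse j (π t)
  regretMatching : ∀ t ∈ Finset.Icc 1 T, ∀ s : S i,
    0 < ∑ b, max (G.cumRegret i π t s b) 0 →
    ∀ a, (π t i s).1 a =
      max (G.cumRegret i π t s a) 0 / ∑ b, max (G.cumRegret i π t s b) 0

/-- `π` is an `ε`-Nash equilibrium: no player gains more than `ε` by a change of policy. -/
def IsNash (G : EFGame A S) (ε : ℝ) (π : G.JointPolicy) : Prop :=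
  ∀ (j : Fin 2) (β : G.Policy j), G.value j (Function.update π j β) - G.value j π ≤ ε

/-- `σ` is player `i`'s part of an `ε`-Nash equilibrium. -/
def IsEquilibriumPolicy (G : EFGame A S) (i : Fin 2) (ε : ℝ) (σ : G.Policy i) : Prop :=
  ∃ π : G.JointPolicy, π i = σ ∧ G.IsNash ε π

/-- The range of utilities of player `i`: the largest difference between two terminal utilities
(a maximum over a finite nonempty set). -/
noncomputable def utilityRange (G : EFGame A S) (i : Fin 2) : ℝ :=
  ⨆ p : G.terminals × G.terminals, (G.utility i p.1 - G.utility i p.2)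

/-- The largest number of actions at an information state of player `i`. -/
def maxActions (G : EFGame A S) (i : Fin 2) [Fintype (S i)] : ℕ :=
  Finset.univ.sup fun s : S i => (G.actions i s).card

/-- The bound on the average regret of the CFR player `i` after `T` iterations. -/
noncomputable def cfrbrBound (G : EFGame A S) (i : Fin 2) [Fintype (S i)] (T : ℕ) : ℝ :=
  G.utilityRange i * Fintype.card (S i) * √(G.maxActions i) / √T

end EFGame

/-!
The proof combines three facts about a two-player zero-sum game with perfect recall.

* No regret. When player `i` changes its policy, the change of its value is a sum over the nodes
  of the tree of local changes, with the new policy used above the node and the old one below it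
  (`EFGame.subtreeSum_sub_subtreeSum`). Perfect recall makes `i`'s own probability of reaching a
  node a function of the information state, so the sum groups into counterfactual regrets
  (`EFGame.PerfectRecall.value_update_sub_value`). At each information state, regret matching
  keeps the positive part of the accumulated regrets of order `√T`, because each new regret vector
  is orthogonal to it (`sum_sq_posPart_add_le`) and has entries bounded by the range of utilities
  (`EFGame.PerfectRecall.abs_cfRegret_le`). Hence the average regret of player `i` is at most the
  bound `ε` (`EFGame.IsCFRBR.sum_regret_le`).
* Averaging. By perfect recall of the opponent, its average policy `b` earns against every policy
  what the policies `b^t` earn on average (`EFGame.PerfectRecall.card_mul_value_avgPolicy`).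
* Best responses. As `b^t` is a best response in a zero-sum game, the value `v t` of the iterate `t`
  is what that iterate guarantees to player `i`.

If `v t` is the largest of these values, it is at least their average, so that no policy of player
`i` earns more than `v t + ε` against `b`, while the iterate `t` earns at least `v t` against any
opponent. Both deviations from the iterate `t` paired with `b` therefore gain at most `ε`, which is
even better than the required `2 ε` (`EFGame.IsCFRBR.isNash_update_avgPolicy`).
-/

namespace EFGame

variable {A : Type*} {S : Fin 2 → Type*}

/-! ### Sums over the histories below a given one -/

/-- The actions available at a history. -/
def nextActions (G : EFGame A S) (h : List A) : Finset A :=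
  match G.node h with
  | .terminal _ => ∅
  | .chance acts _ => acts
  | .decision i s => G.actions i s

theorem append_mem_iff (G : EFGame A S) (h : List A) (a : A) :
    h ++ [a] ∈ G.histories ↔ h ∈ G.histories ∧ a ∈ G.nextActions h := by
  rw [G.append_mem, nextActions]
  cases G.node h <;> simp

theorem mem_histories_of_append (G : EFGame A S) (h l : List A)
    (hl : h ++ l ∈ G.histories) : h ∈ G.histories := by
  induction l using List.reverseRecOn with
  | nil => simpa using hl
  | append_singleton l a ih =>
    rw [← List.append_assoc, append_mem_iff] at hl
    exact ih hl.1

/-- Induction from the leaves of the game tree towards the root. -/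
theorem histories_induction (G : EFGame A S) {P : List A → Prop}
    (step : ∀ h ∈ G.histories, (∀ a ∈ G.nextActions h, P (h ++ [a])) → P h) :
    ∀ h ∈ G.histories, P h := by
  have key : ∀ n : ℕ, ∀ h ∈ G.histories, G.histories.sup List.length - h.length = n → P h := by
    intro n
    induction n using Nat.strong_induction_on with
    | _ n ih =>
      intro h hh hn
      refine step h hh fun a ha => ?_
      have hm : h ++ [a] ∈ G.histories := (G.append_mem_iff h a).2 ⟨hh, ha⟩
      have hle : (h ++ [a]).length ≤ G.histories.sup List.length :=
        Finset.le_sup (f := List.length) hm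
      rw [List.length_append, List.length_singleton] at hle
      refine ih _ ?_ (h ++ [a]) hm rfl
      rw [List.length_append, List.length_singleton]
      omega
  exact fun h hh => key _ h hh rfl

theorem prodFrom_append (w : List A → A → ℝ) (h l l' : List A) :
    prodFrom w h (l ++ l') = prodFrom w h l * prodFrom w (h ++ l) l' := by
  induction l generalizing h with
  | nil => simp [prodFrom]
  | cons a l ih => simp [prodFrom, ih, mul_assoc]

open Classical in
/-- The sum of `F` over the histories extending `h`, each weighted by the product of the
factors `w` along the way from `h`. Expected utilities, as well as sums of reach probabilities
over a set of histories, are of this form. -/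
noncomputable def subtreeSum (G : EFGame A S) (w : List A → A → ℝ) (F : List A → ℝ)
    (h : List A) : ℝ :=
  ∑ h' ∈ G.histories.filter (fun h' => h <+: h'), prodFrom w h (h'.drop h.length) * F h'

theorem subtreeSum_nil (G : EFGame A S) (w : List A → A → ℝ) (F : List A → ℝ) :
    G.subtreeSum w F [] = ∑ h ∈ G.histories, prodFrom w [] h * F h := by
  simp [subtreeSum]

theorem subtreeSum_eq (G : EFGame A S) (w : List A → A → ℝ) (F : List A → ℝ)
    {h : List A} (hh : h ∈ G.histories) :
    G.subtreeSum w F h =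
      F h + ∑ a ∈ G.nextActions h, w h a * G.subtreeSum w F (h ++ [a]) := by
  classical
  have hsplit : G.histories.filter (fun h' => h <+: h') =
      insert h ((G.nextActions h).biUnion
        fun a => G.histories.filter (fun h' => h ++ [a] <+: h')) := by
    ext h'
    simp only [Finset.mem_filter, Finset.mem_insert, Finset.mem_biUnion]
    constructor
    · rintro ⟨hm, t, rfl⟩
      cases t with
      | nil => simp
      | cons a t =>
        right
        have hm' : (h ++ [a]) ++ t ∈ G.histories := by simpa using hm
        exact ⟨a, ((G.append_mem_iff h a).1 (G.mem_histories_of_append _ _ hm')).2, hm,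
          t, by simp⟩
    · rintro (rfl | ⟨a, -, hm, hp⟩)
      · exact ⟨hh, List.prefix_rfl⟩
      · exact ⟨hm, (List.prefix_append h [a]).trans hp⟩
  have hnot : h ∉ (G.nextActions h).biUnion
      fun a => G.histories.filter (fun h' => h ++ [a] <+: h') := by
    simp only [Finset.mem_biUnion, Finset.mem_filter, not_exists, not_and]
    intro a _ _ hp
    have := hp.length_le
    simp at this
  have hdisj : ((G.nextActions h : Finset A) : Set A).PairwiseDisjoint
      fun a => G.histories.filter (fun h' => h ++ [a] <+: h') := by
    intro a _ b _ hab
    refine Finset.disjoint_left.2 fun h' ha hb => hab ?_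
    obtain ⟨t, rfl⟩ := (Finset.mem_filter.1 ha).2
    obtain ⟨t', ht'⟩ := (Finset.mem_filter.1 hb).2
    simp at ht'
    exact ht'.1.symm
  unfold subtreeSum
  rw [hsplit, Finset.sum_insert hnot, Finset.sum_biUnion hdisj]
  congr 1
  · simp [prodFrom]
  · refine Finset.sum_congr rfl fun a _ => ?_
    rw [Finset.mul_sum]
    refine Finset.sum_congr rfl fun h' hh' => ?_
    obtain ⟨t, rfl⟩ := (Finset.mem_filter.1 hh').2
    rw [List.drop_left, List.append_assoc, List.drop_left, List.singleton_append, prodFrom,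
      mul_assoc]

/-- Changing the factors one node at a time: two weighted sums differ by the sum, over all
nodes, of the local effect of the change when `w'` is used above the node and `w` below it. -/
theorem subtreeSum_sub_subtreeSum (G : EFGame A S) (w w' : List A → A → ℝ) (F : List A → ℝ) :
    ∀ h ∈ G.histories, G.subtreeSum w' F h - G.subtreeSum w F h =
      G.subtreeSum w' (fun h' => ∑ a ∈ G.nextActions h',
        (w' h' a - w h' a) * G.subtreeSum w F (h' ++ [a])) h := by
  refine G.histories_induction fun h hh ih => ?_
  rw [G.subtreeSum_eq w' F hh, G.subtreeSum_eq w F hh, G.subtreeSum_eq w' _ hh,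
    add_sub_add_left_eq_sub, ← Finset.sum_sub_distrib, ← Finset.sum_add_distrib]
  refine Finset.sum_congr rfl fun a ha => ?_
  rw [← ih a ha]
  ring

/-! ### Step probabilities, values and reach probabilities -/

open Classical in
/-- The probability, under `π`, of the action recorded in an entry of a player's experience. -/
noncomputable def actionProb (G : EFGame A S) (π : G.JointPolicy) (e : (Σ j, S j) × A) : ℝ :=
  if ha : e.2 ∈ G.actions e.1.1 e.1.2 then (π e.1.1 e.1.2).1 ⟨e.2, ha⟩ else 0

theorem actionProb_nonneg (G : EFGame A S) (π : G.JointPolicy) (e : (Σ j, S j) × A) :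
    0 ≤ G.actionProb π e := by
  unfold actionProb
  split_ifs with ha
  · exact (π e.1.1 e.1.2).2.1 _
  · exact le_rfl

theorem actionProb_le_one (G : EFGame A S) (π : G.JointPolicy) (e : (Σ j, S j) × A) :
    G.actionProb π e ≤ 1 := by
  unfold actionProb
  split_ifs with ha
  · rw [← (π e.1.1 e.1.2).2.2]
    exact Finset.single_le_sum (fun b _ => (π e.1.1 e.1.2).2.1 b) (Finset.mem_univ _)
  · exact zero_le_one

theorem actionProb_coe (G : EFGame A S) (π : G.JointPolicy) {i : Fin 2} (s : S i)
    (a : G.actions i s) : G.actionProb π (⟨i, s⟩, a) = (π i s).1 a := by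
  simp [actionProb]

theorem stepProb_of_decision (G : EFGame A S) (π : G.JointPolicy) {h : List A} {i : Fin 2}
    {s : S i} (hn : G.node h = .decision i s) (a : A) :
    G.stepProb π h a = G.actionProb π (⟨i, s⟩, a) := by
  simp [stepProb, hn, actionProb]

theorem stepProb_nonneg (G : EFGame A S) (π : G.JointPolicy) (h : List A) (a : A) :
    0 ≤ G.stepProb π h a := by
  unfold stepProb
  split
  · exact le_rfl
  · split_ifs
    · rename_i p _ _
      exact p.2.1 _
    · exact le_rfl
  · split_ifs
    · rename_i i s _ _
      exact (π i s).2.1 _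
    · exact le_rfl

theorem sum_stepProb (G : EFGame A S) (π : G.JointPolicy) {h : List A}
    (hn : ∀ u, G.node h ≠ .terminal u) :
    ∑ a ∈ G.nextActions h, G.stepProb π h a = 1 := by
  cases hh : G.node h with
  | terminal u => exact absurd hh (hn u)
  | chance acts p =>
    have e : G.nextActions h = acts := by simp [nextActions, hh]
    rw [e, ← p.2.2, ← Finset.sum_coe_sort]
    refine Finset.sum_congr rfl fun a _ => ?_
    simp [stepProb, hh]
  | decision i s =>
    have e : G.nextActions h = G.actions i s := by simp [nextActions, hh]
    rw [e, ← (π i s).2.2, ← Finset.sum_coe_sort]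
    refine Finset.sum_congr rfl fun a _ => ?_
    rw [G.stepProb_of_decision π hh, actionProb_coe]

theorem utility_of_not_terminal (G : EFGame A S) (i : Fin 2) {h : List A}
    (hn : ∀ u, G.node h ≠ .terminal u) : G.utility i h = 0 := by
  unfold utility
  split
  · rename_i u hu
    exact absurd hu (hn u)
  · rfl

theorem mem_terminals (G : EFGame A S) {z : List A} :
    z ∈ G.terminals ↔ z ∈ G.histories ∧ ∃ u, G.node z = .terminal u := by
  simp [terminals]

theorem value_eq_subtreeSum (G : EFGame A S) (i : Fin 2) (π : G.JointPolicy) :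
    G.value i π = G.subtreeSum (G.stepProb π) (G.utility i) [] := by
  rw [subtreeSum_nil, value]
  refine Finset.sum_subset (fun z hz => (G.mem_terminals.1 hz).1) fun h hh hn => ?_
  rw [G.utility_of_not_terminal i, mul_zero]
  exact fun u hu => hn (G.mem_terminals.2 ⟨hh, u, hu⟩)

theorem histActionValue_eq_subtreeSum (G : EFGame A S) (i : Fin 2) (π : G.JointPolicy)
    (h : List A) (a : A) :
    G.histActionValue i π h a = G.subtreeSum (G.stepProb π) (G.utility i) (h ++ [a]) := by
  classical
  rw [subtreeSum, histActionValue]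
  refine Finset.sum_subset ?_ fun h' hh hn => ?_
  · intro h'
    simp only [Finset.mem_filter, mem_terminals]
    tauto
  · rw [G.utility_of_not_terminal i, mul_zero]
    intro u hu
    rw [Finset.mem_filter] at hh
    exact hn (Finset.mem_filter.2 ⟨G.mem_terminals.2 ⟨hh.1, u, hu⟩, hh.2⟩)

theorem experienceFrom_append (G : EFGame A S) (i : Fin 2) (h l l' : List A) :
    G.experienceFrom i h (l ++ l') =
      G.experienceFrom i h l ++ G.experienceFrom i (h ++ l) l' := by
  induction l generalizing h with
  | nil => simp [experienceFrom]
  | cons a l ih =>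
    simp only [List.cons_append, experienceFrom, ih, List.append_assoc, List.nil_append]
    split
    · split_ifs <;> simp
    · rfl

theorem experienceFrom_append_of_decision (G : EFGame A S) {i : Fin 2} {h : List A} {s : S i}
    (hn : G.node h = .decision i s) (a : A) :
    G.experienceFrom i [] (h ++ [a]) = G.experienceFrom i [] h ++ [(⟨i, s⟩, a)] := by
  simp [experienceFrom_append, experienceFrom, hn]

theorem experienceFrom_append_of_not_decision (G : EFGame A S) {i : Fin 2} {h : List A}
    (hn : ∀ s : S i, G.node h ≠ .decision i s) (a : A) :
    G.experienceFrom i [] (h ++ [a]) = G.experienceFrom i [] h := by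
  rw [experienceFrom_append]
  simp only [List.nil_append, experienceFrom]
  split
  · rename_i j s hs
    split_ifs with hj
    · subst hj
      exact absurd hs (hn s)
    · simp
  · simp

theorem fst_of_mem_experienceFrom (G : EFGame A S) (i : Fin 2) (h l : List A) :
    ∀ e ∈ G.experienceFrom i h l, e.1.1 = i := by
  induction l generalizing h with
  | nil => simp [experienceFrom]
  | cons a l ih =>
    intro e he
    simp only [experienceFrom] at he
    split at he
    · split_ifs at he with hj
      · rcases List.mem_cons.1 he with rfl | he
        · exact hj
        · exact ih _ e he
      · exact ih _ e he
    · exact ih _ e he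

/-- Player `i`'s own contribution to the probability of reaching `h`. It is defined through the
experience of the player, so that perfect recall makes it a function of the information
state. -/
noncomputable def ownReach (G : EFGame A S) (i : Fin 2) (π : G.JointPolicy) (h : List A) : ℝ :=
  ((G.experienceFrom i [] h).map (G.actionProb π)).prod

theorem ownReach_nonneg (G : EFGame A S) (i : Fin 2) (π : G.JointPolicy) (h : List A) :
    0 ≤ G.ownReach i π h := by
  refine List.prod_nonneg fun x hx => ?_
  obtain ⟨e, -, rfl⟩ := List.mem_map.1 hx
  exact G.actionProb_nonneg π e

theorem ownReach_le_one (G : EFGame A S) (i : Fin 2) (π : G.JointPolicy) (h : List A) :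
    G.ownReach i π h ≤ 1 := by
  unfold ownReach
  induction G.experienceFrom i [] h with
  | nil => simp
  | cons e l ih =>
    rw [List.map_cons, List.prod_cons]
    refine mul_le_one₀ (G.actionProb_le_one π e) (List.prod_nonneg fun x hx => ?_) ih
    obtain ⟨e, -, rfl⟩ := List.mem_map.1 hx
    exact G.actionProb_nonneg π e

theorem ownReach_congr (G : EFGame A S) {i : Fin 2} {π π' : G.JointPolicy} (hπ : π i = π' i)
    (h : List A) : G.ownReach i π h = G.ownReach i π' h := by
  unfold ownReach
  congr 1
  refine List.map_congr_left fun e he => ?_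
  obtain ⟨⟨j, s⟩, a⟩ := e
  obtain rfl : j = i := G.fst_of_mem_experienceFrom i [] h _ he
  simp [actionProb, hπ]

theorem PerfectRecall.ownReach_eq {G : EFGame A S} (hG : G.PerfectRecall) {i : Fin 2} {s : S i}
    (π : G.JointPolicy) {h h' : List A} (hh : h ∈ G.stateHistories i s)
    (hh' : h' ∈ G.stateHistories i s) : G.ownReach i π h = G.ownReach i π h' := by
  rw [ownReach, ownReach, hG i s h hh h' hh']

theorem othersReach_congr (G : EFGame A S) {i : Fin 2} {π π' : G.JointPolicy}
    (hπ : ∀ j, j ≠ i → π j = π' j) (h : List A) :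
    G.othersReach i π h = G.othersReach i π' h := by
  have : G.othersStepProb i π = G.othersStepProb i π' := by
    funext h a
    unfold othersStepProb stepProb
    cases G.node h with
    | terminal u => rfl
    | chance acts p => rfl
    | decision j s =>
      by_cases hj : j = i
      · simp [hj]
      · simp [hj, hπ j hj]
  rw [othersReach, othersReach, this]

theorem othersStepProb_nonneg (G : EFGame A S) (i : Fin 2) (π : G.JointPolicy) (h : List A)
    (a : A) : 0 ≤ G.othersStepProb i π h a := by
  unfold othersStepProb
  split
  · split_ifs
    · exact zero_le_one
    · exact G.stepProb_nonneg π h a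
  · exact G.stepProb_nonneg π h a

theorem othersStepProb_of_not_decision (G : EFGame A S) {i : Fin 2} (π : G.JointPolicy)
    {h : List A} (hn : ∀ s : S i, G.node h ≠ .decision i s) (a : A) :
    G.othersStepProb i π h a = G.stepProb π h a := by
  unfold othersStepProb
  split
  · rename_i j s hs
    split_ifs with hj
    · subst hj
      exact absurd hs (hn s)
    · rfl
  · rfl

theorem othersStepProb_of_decision (G : EFGame A S) {i : Fin 2} (π : G.JointPolicy)
    {h : List A} {s : S i} (hn : G.node h = .decision i s) (a : A) :
    G.othersStepProb i π h a = 1 := by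
  simp [othersStepProb, hn]

theorem prodFrom_nonneg {w : List A → A → ℝ} (hw : ∀ h a, 0 ≤ w h a) (h l : List A) :
    0 ≤ prodFrom w h l := by
  induction l generalizing h with
  | nil => exact zero_le_one
  | cons a l ih => exact mul_nonneg (hw h a) (ih _)

theorem othersReach_nonneg (G : EFGame A S) (i : Fin 2) (π : G.JointPolicy) (h : List A) :
    0 ≤ G.othersReach i π h :=
  prodFrom_nonneg (G.othersStepProb_nonneg i π) [] h

theorem reach_eq (G : EFGame A S) (i : Fin 2) (π : G.JointPolicy) (h : List A) :
    G.reach π h = G.ownReach i π h * G.othersReach i π h := by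
  unfold reach othersReach
  induction h using List.reverseRecOn with
  | nil => simp [prodFrom, ownReach, experienceFrom]
  | append_singleton h a ih =>
    rw [prodFrom_append, prodFrom_append, ih]
    simp only [List.nil_append, prodFrom, mul_one]
    by_cases hn : ∃ s : S i, G.node h = .decision i s
    · obtain ⟨s, hs⟩ := hn
      rw [G.stepProb_of_decision π hs, G.othersStepProb_of_decision π hs, ownReach, ownReach,
        G.experienceFrom_append_of_decision hs]
      simp
      ring
    · push Not at hn
      rw [G.othersStepProb_of_not_decision π hn, ownReach, ownReach,
        G.experienceFrom_append_of_not_decision hn]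
      ring

theorem mem_stateHistories (G : EFGame A S) {i : Fin 2} {s : S i} {h : List A} :
    h ∈ G.stateHistories i s ↔ h ∈ G.histories ∧ G.node h = .decision i s := by
  simp [stateHistories]

/-- The others' contributions to reaching an information state `s` of `i` sum to at most one:
they are the probability of reaching `s` when `i` plays towards `s`. Under perfect recall only
one action of `i` at each history leads to `s`, and no history in `s` extends another one. -/
theorem PerfectRecall.sum_othersReach_le_one {G : EFGame A S} (hG : G.PerfectRecall)
    (i : Fin 2) (s : S i) (π : G.JointPolicy) :
    ∑ h ∈ G.stateHistories i s, G.othersReach i π h ≤ 1 := by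
  classical
  obtain ⟨h₀, hh₀, hn₀⟩ := G.state_nonempty i s
  have hs₀ : h₀ ∈ G.stateHistories i s := G.mem_stateHistories.2 ⟨hh₀, hn₀⟩
  set e := G.experienceFrom i [] h₀
  let F : List A → ℝ := fun h => if h ∈ G.stateHistories i s then 1 else 0
  let W := G.subtreeSum (G.othersStepProb i π) F
  have hzero : ∀ h, ¬ (G.experienceFrom i [] h <+: e) → W h = 0 := by
    intro h hh
    refine Finset.sum_eq_zero fun h' hh' => ?_
    have hF : F h' = 0 := by
      refine if_neg fun hs => hh ?_
      obtain ⟨t, rfl⟩ := (Finset.mem_filter.1 hh').2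
      have := hG i s _ hs _ hs₀
      rw [experienceFrom_append] at this
      exact ⟨_, this⟩
    rw [hF, mul_zero]
  have hW : ∀ h ∈ G.histories, W h ≤ 1 := by
    refine G.histories_induction fun h hh ih => ?_
    have hrec : W h = F h + ∑ a ∈ G.nextActions h, G.othersStepProb i π h a * W (h ++ [a]) :=
      G.subtreeSum_eq _ _ hh
    rw [hrec]
    by_cases hn : ∃ s' : S i, G.node h = .decision i s'
    · obtain ⟨s', hs'⟩ := hn
      simp only [G.othersStepProb_of_decision π hs', one_mul]
      by_cases hs : h ∈ G.stateHistories i s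
      · have : ∑ a ∈ G.nextActions h, W (h ++ [a]) = 0 := by
          refine Finset.sum_eq_zero fun a _ => hzero _ fun hp => ?_
          rw [G.experienceFrom_append_of_decision hs', hG i s h hs h₀ hs₀] at hp
          have := hp.length_le
          simp [e] at this
        rw [this, add_zero]
        simp [F, hs]
      · have hF : F h = 0 := if_neg hs
        rw [hF, zero_add]
        by_cases hex : ∃ a ∈ G.nextActions h, G.experienceFrom i [] (h ++ [a]) <+: e
        · obtain ⟨a, ha, hp⟩ := hex
          rw [Finset.sum_eq_single a]
          · exact ih a ha
          · intro b _ hb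
            refine hzero _ fun hq => hb ?_
            rw [G.experienceFrom_append_of_decision hs'] at hp hq
            have := List.prefix_of_prefix_length_le hp hq (by simp)
            have := this.eq_of_length (by simp)
            simp at this
            exact this.symm
          · exact fun hna => absurd ha hna
        · push Not at hex
          rw [Finset.sum_eq_zero fun a ha => hzero _ (hex a ha)]
          exact zero_le_one
    · push Not at hn
      have hF : F h = 0 := if_neg fun hs => hn s (G.mem_stateHistories.1 hs).2
      rw [hF, zero_add]
      simp only [G.othersStepProb_of_not_decision π hn]
      by_cases ht : ∃ u, G.node h = .terminal u
      · obtain ⟨u, hu⟩ := ht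
        simp [nextActions, hu]
      · push Not at ht
        rw [← G.sum_stepProb π ht]
        exact Finset.sum_le_sum fun a ha =>
          mul_le_of_le_one_right (G.stepProb_nonneg π h a) (ih a ha)
  have h1 := hW [] G.nil_mem
  simp only [W, subtreeSum_nil] at h1
  refine le_trans (le_of_eq ?_) h1
  simp only [F, mul_ite, mul_one, mul_zero]
  rw [← Finset.sum_filter]
  refine Finset.sum_congr ?_ fun _ _ => rfl
  ext h
  simp only [Finset.mem_filter, mem_stateHistories]
  tauto

/-! ### The size of counterfactual regrets -/

theorem sub_utility_le_utilityRange (G : EFGame A S) (i : Fin 2) {z z' : List A}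
    (hz : z ∈ G.terminals) (hz' : z' ∈ G.terminals) :
    G.utility i z - G.utility i z' ≤ G.utilityRange i :=
  le_ciSup (f := fun p : G.terminals × G.terminals => G.utility i p.1 - G.utility i p.2)
    (Set.finite_range _).bddAbove (⟨z, hz⟩, ⟨z', hz'⟩)

theorem utilityRange_nonneg (G : EFGame A S) (i : Fin 2) : 0 ≤ G.utilityRange i := by
  by_cases hz : G.terminals.Nonempty
  · obtain ⟨z, hz⟩ := hz
    simpa using G.sub_utility_le_utilityRange i hz hz
  · rw [Finset.not_nonempty_iff_eq_empty] at hz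
    have : IsEmpty (G.terminals × G.terminals) := by rw [hz]; infer_instance
    rw [utilityRange, Real.iSup_of_isEmpty]

theorem subtreeSum_utility_mem_Icc (G : EFGame A S) (i : Fin 2) (π : G.JointPolicy) {m M : ℝ}
    (hm : ∀ z ∈ G.terminals, G.utility i z ∈ Set.Icc m M) :
    ∀ h ∈ G.histories, G.subtreeSum (G.stepProb π) (G.utility i) h ∈ Set.Icc m M := by
  refine G.histories_induction fun h hh ih => ?_
  rw [G.subtreeSum_eq _ _ hh]
  by_cases ht : ∃ u, G.node h = .terminal u
  · have hz : h ∈ G.terminals := G.mem_terminals.2 ⟨hh, ht⟩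
    obtain ⟨u, hu⟩ := ht
    have he : G.nextActions h = ∅ := by simp [nextActions, hu]
    rw [he, Finset.sum_empty, add_zero]
    exact hm h hz
  · push Not at ht
    rw [G.utility_of_not_terminal i ht, zero_add]
    exact (convex_Icc m M).sum_mem (fun a _ => G.stepProb_nonneg π h a) (G.sum_stepProb π ht) ih

theorem abs_histActionValue_sub_le (G : EFGame A S) (i : Fin 2) (π : G.JointPolicy) {s : S i}
    {h : List A} (hh : h ∈ G.stateHistories i s) (a b : G.actions i s) :
    |G.histActionValue i π h a - G.histActionValue i π h b| ≤ G.utilityRange i := by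
  obtain ⟨hm, hn⟩ := G.mem_stateHistories.1 hh
  have hmem : ∀ c : G.actions i s, h ++ [(c : A)] ∈ G.histories := fun c =>
    (G.append_mem_iff h c).2 ⟨hm, by simp [nextActions, hn]⟩
  by_cases hz : G.terminals.Nonempty
  · obtain ⟨z, hz, hz'⟩ := G.terminals.exists_min_image (G.utility i) hz
    have hb : ∀ z' ∈ G.terminals,
        G.utility i z' ∈ Set.Icc (G.utility i z) (G.utility i z + G.utilityRange i) :=
      fun z' h' => ⟨hz' z' h', by linarith [G.sub_utility_le_utilityRange i h' hz]⟩
    have ha := G.subtreeSum_utility_mem_Icc i π hb _ (hmem a)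
    have hb := G.subtreeSum_utility_mem_Icc i π hb _ (hmem b)
    rw [← histActionValue_eq_subtreeSum] at ha hb
    rw [abs_sub_le_iff]
    constructor <;> linarith [ha.1, ha.2, hb.1, hb.2]
  · rw [Finset.not_nonempty_iff_eq_empty] at hz
    simpa [histActionValue, hz] using G.utilityRange_nonneg i

theorem sum_mul_cfRegret (G : EFGame A S) (i : Fin 2) (π : G.JointPolicy) (s : S i) :
    ∑ a, (π i s).1 a * G.cfRegret i π s a = 0 := by
  simp only [cfRegret, mul_sub, Finset.sum_sub_distrib, ← Finset.sum_mul]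
  rw [(π i s).2.2, one_mul, cfValue, sub_self]

theorem PerfectRecall.abs_cfRegret_le {G : EFGame A S} (hG : G.PerfectRecall) (i : Fin 2)
    (π : G.JointPolicy) (s : S i) (a : G.actions i s) :
    |G.cfRegret i π s a| ≤ G.utilityRange i := by
  have hpair : ∀ b, |G.cfActionValue i π s a - G.cfActionValue i π s b| ≤ G.utilityRange i := by
    intro b
    simp only [cfActionValue]
    rw [← Finset.sum_sub_distrib]
    calc _ ≤ ∑ h ∈ G.stateHistories i s, |G.othersReach i π h * G.histActionValue i π h a -
            G.othersReach i π h * G.histActionValue i π h b| := Finset.abs_sum_le_sum_abs _ _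
      _ ≤ ∑ h ∈ G.stateHistories i s, G.othersReach i π h * G.utilityRange i := by
          refine Finset.sum_le_sum fun h hh => ?_
          rw [← mul_sub, abs_mul, abs_of_nonneg (G.othersReach_nonneg i π h)]
          exact mul_le_mul_of_nonneg_left (G.abs_histActionValue_sub_le i π hh a b)
            (G.othersReach_nonneg i π h)
      _ = (∑ h ∈ G.stateHistories i s, G.othersReach i π h) * G.utilityRange i := by
          rw [Finset.sum_mul]
      _ ≤ G.utilityRange i :=
          mul_le_of_le_one_left (G.utilityRange_nonneg i) (hG.sum_othersReach_le_one i s π)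
  have heq : G.cfRegret i π s a =
      ∑ b, (π i s).1 b * (G.cfActionValue i π s a - G.cfActionValue i π s b) := by
    simp only [mul_sub, Finset.sum_sub_distrib, ← Finset.sum_mul]
    rw [(π i s).2.2, one_mul, cfRegret, cfValue]
  rw [heq]
  calc _ ≤ ∑ b, |(π i s).1 b * (G.cfActionValue i π s a - G.cfActionValue i π s b)| :=
        Finset.abs_sum_le_sum_abs _ _
    _ ≤ ∑ b, (π i s).1 b * G.utilityRange i := by
        refine Finset.sum_le_sum fun b _ => ?_
        rw [abs_mul, abs_of_nonneg ((π i s).2.1 b)]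
        exact mul_le_mul_of_nonneg_left (hpair b) ((π i s).2.1 b)
    _ = G.utilityRange i := by rw [← Finset.sum_mul, (π i s).2.2, one_mul]

/-! ### Regret decomposes over information states -/

/-- The gain of player `i` from switching to another policy is the sum over its information
states of the expected counterfactual regret there, weighted by its own probability of playing
to the state under the new policy. By perfect recall that probability is the same at all
histories `h s` of the state `s`. -/
theorem PerfectRecall.value_update_sub_value {G : EFGame A S} (hG : G.PerfectRecall)
    (i : Fin 2) [Fintype (S i)] (π : G.JointPolicy) (σ : G.Policy i) (h : S i → List A)
    (hh : ∀ s, h s ∈ G.stateHistories i s) :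
    G.value i (Function.update π i σ) - G.value i π =
      ∑ s, G.ownReach i (Function.update π i σ) (h s) * ∑ a, (σ s).1 a * G.cfRegret i π s a := by
  classical
  set π' := Function.update π i σ with hπ'
  have hπi : π' i = σ := by simp [hπ']
  have hπj : ∀ j, j ≠ i → π' j = π j := fun j hj => by simp [hπ', hj]
  rw [value_eq_subtreeSum, value_eq_subtreeSum,
    G.subtreeSum_sub_subtreeSum _ _ _ [] G.nil_mem, subtreeSum_nil]
  have hlocal : ∀ h' ∈ G.histories, prodFrom (G.stepProb π') [] h' *
      ∑ a ∈ G.nextActions h', (G.stepProb π' h' a - G.stepProb π h' a) *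
        G.subtreeSum (G.stepProb π) (G.utility i) (h' ++ [a]) =
      ∑ s : S i, if G.node h' = .decision i s then
        G.ownReach i π' (h s) * ∑ a, ((σ s).1 a - (π i s).1 a) *
          (G.othersReach i π h' * G.histActionValue i π h' a) else 0 := by
    intro h' hm
    by_cases hn : ∃ s : S i, G.node h' = .decision i s
    · obtain ⟨s, hs⟩ := hn
      rw [Finset.sum_eq_single s]
      · rw [if_pos hs]
        have hr : prodFrom (G.stepProb π') [] h' =
            G.ownReach i π' (h s) * G.othersReach i π h' := by
          rw [hG.ownReach_eq π' (hh s) (G.mem_stateHistories.2 ⟨hm, hs⟩),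
            ← G.othersReach_congr hπj h', ← reach_eq, reach]
        have he : G.nextActions h' = G.actions i s := by simp [nextActions, hs]
        rw [hr, he, ← Finset.sum_coe_sort, mul_assoc, Finset.mul_sum]
        congr 1
        refine Finset.sum_congr rfl fun a _ => ?_
        rw [G.stepProb_of_decision π' hs, G.stepProb_of_decision π hs, actionProb_coe,
          actionProb_coe, hπi, histActionValue_eq_subtreeSum]
        ring
      · intro s' _ hne
        refine if_neg fun hs' => hne ?_
        rw [hs] at hs'
        injection hs' with _ h2
        exact h2.symm
      · exact fun hs' => absurd (Finset.mem_univ s) hs'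
    · push Not at hn
      rw [Finset.sum_eq_zero (s := Finset.univ) fun s _ => if_neg (hn s),
        Finset.sum_eq_zero (s := G.nextActions h'), mul_zero]
      intro a _
      have hstep : G.stepProb π' h' a = G.stepProb π h' a := by
        unfold stepProb
        cases hc : G.node h' with
        | terminal u => rfl
        | chance acts p => rfl
        | decision j s =>
          have hj : j ≠ i := by
            rintro rfl
            exact hn s hc
          simp [hπj j hj]
      rw [hstep, sub_self, zero_mul]
  rw [Finset.sum_congr rfl hlocal, Finset.sum_comm]
  refine Finset.sum_congr rfl fun s _ => ?_
  rw [← Finset.sum_filter, ← Finset.mul_sum, Finset.sum_comm]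
  congr 1
  have hset : G.histories.filter (fun h' => G.node h' = .decision i s) =
      G.stateHistories i s := by
    ext h'
    simp [mem_stateHistories]
  rw [hset]
  have h1 : ∀ a, ∑ h' ∈ G.stateHistories i s, ((σ s).1 a - (π i s).1 a) *
      (G.othersReach i π h' * G.histActionValue i π h' a) =
      (σ s).1 a * G.cfActionValue i π s a - (π i s).1 a * G.cfActionValue i π s a := by
    intro a
    rw [← Finset.mul_sum, ← sub_mul, cfActionValue]
  rw [Finset.sum_congr rfl fun a _ => h1 a]
  simp only [cfRegret, mul_sub, Finset.sum_sub_distrib, ← Finset.sum_mul]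
  rw [(σ s).2.2, one_mul, cfValue]

end EFGame

/-! ### Regret matching -/

/-- One step of regret matching: if the regret vector `r` is orthogonal to the positive part of
the accumulated regrets `R`, then the squared norm of that positive part grows by at most the
squared norm of `r`. -/
theorem sum_sq_posPart_add_le {ι : Type*} [Fintype ι] (R r : ι → ℝ)
    (h : ∑ a, max (R a) 0 * r a = 0) :
    ∑ a, max (R a + r a) 0 ^ 2 ≤ ∑ a, max (R a) 0 ^ 2 + ∑ a, r a ^ 2 := by
  have hpt : ∀ a, max (R a + r a) 0 ^ 2 ≤ max (R a) 0 ^ 2 + r a ^ 2 + 2 * (max (R a) 0 * r a) := by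
    intro a
    have h1 : max (R a + r a) 0 ^ 2 ≤ (max (R a) 0 + r a) ^ 2 := by
      rcases le_total (R a + r a) 0 with hn | hp
      · rw [max_eq_right hn, zero_pow two_ne_zero]
        positivity
      · rw [max_eq_left hp]
        have := le_max_left (R a) 0
        gcongr
    linarith [h1, add_sq (max (R a) 0) (r a)]
  calc _ ≤ ∑ a, (max (R a) 0 ^ 2 + r a ^ 2 + 2 * (max (R a) 0 * r a)) :=
        Finset.sum_le_sum fun a _ => hpt a
    _ = _ := by
      rw [Finset.sum_add_distrib, Finset.sum_add_distrib, ← Finset.mul_sum, h]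
      ring

namespace EFGame

variable {A : Type*} {S : Fin 2 → Type*}

theorem IsCFRBR.sum_sq_posPart_cumRegret_le {G : EFGame A S} (hG : G.PerfectRecall) {i : Fin 2}
    {T : ℕ} {π : ℕ → G.JointPolicy} (hπ : G.IsCFRBR i T π) (s : S i) :
    ∀ t ≤ T, ∑ a, max (G.cumRegret i π (t + 1) s a) 0 ^ 2 ≤
      t * ((G.actions i s).card * G.utilityRange i ^ 2) := by
  intro t
  induction t with
  | zero => simp [cumRegret]
  | succ t ih =>
    intro ht
    have hsucc : ∀ a, G.cumRegret i π (t + 1 + 1) s a =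
        G.cumRegret i π (t + 1) s a + G.cfRegret i (π (t + 1)) s a := fun a =>
      Finset.sum_Ico_succ_top (by omega) _
    -- Regret matching makes the current policy proportional to the positive regrets, and the
    -- instantaneous regrets average to zero under the current policy.
    have horth : ∑ a, max (G.cumRegret i π (t + 1) s a) 0 * G.cfRegret i (π (t + 1)) s a = 0 := by
      have hnn : ∀ b ∈ Finset.univ, 0 ≤ max (G.cumRegret i π (t + 1) s b) 0 :=
        fun b _ => le_max_right _ _
      rcases (Finset.sum_nonneg hnn).eq_or_lt with h0 | hpos
      · have := (Finset.sum_eq_zero_iff_of_nonneg hnn).1 h0.symm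
        exact Finset.sum_eq_zero fun a ha => by rw [this a ha, zero_mul]
      · have hp := hπ.regretMatching (t + 1) (Finset.mem_Icc.2 ⟨by omega, ht⟩) s hpos
        have := G.sum_mul_cfRegret i (π (t + 1)) s
        simp only [hp, div_mul_eq_mul_div, ← Finset.sum_div] at this
        rcases div_eq_zero_iff.1 this with h | h
        · exact h
        · exact absurd h hpos.ne'
    have hr : ∑ a, G.cfRegret i (π (t + 1)) s a ^ 2 ≤
        (G.actions i s).card * G.utilityRange i ^ 2 := by
      calc _ ≤ ∑ _a : G.actions i s, G.utilityRange i ^ 2 := by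
            refine Finset.sum_le_sum fun a _ => ?_
            rw [← sq_abs]
            have := hG.abs_cfRegret_le i (π (t + 1)) s a
            gcongr
        _ = _ := by simp
    simp only [hsucc]
    refine (sum_sq_posPart_add_le _ _ horth).trans ?_
    push_cast
    linarith [ih (by omega), hr]

theorem IsCFRBR.cumRegret_le {G : EFGame A S} (hG : G.PerfectRecall) {i : Fin 2}
    [Fintype (S i)] {T : ℕ} {π : ℕ → G.JointPolicy} (hπ : G.IsCFRBR i T π) (s : S i)
    (a : G.actions i s) :
    G.cumRegret i π (T + 1) s a ≤ G.utilityRange i * √(G.maxActions i) * √T := by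
  have h1 : max (G.cumRegret i π (T + 1) s a) 0 ^ 2 ≤
      ∑ a, max (G.cumRegret i π (T + 1) s a) 0 ^ 2 :=
    Finset.single_le_sum (f := fun a => max (G.cumRegret i π (T + 1) s a) 0 ^ 2)
      (fun _ _ => sq_nonneg _) (Finset.mem_univ a)
  have h2 := hπ.sum_sq_posPart_cumRegret_le hG s T le_rfl
  have h3 : ((G.actions i s).card : ℝ) ≤ G.maxActions i := by
    exact_mod_cast Finset.le_sup (f := fun s : S i => (G.actions i s).card) (Finset.mem_univ s)
  have hΔ := G.utilityRange_nonneg i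
  refine (le_max_left _ 0).trans (le_of_sq_le_sq ?_ (by positivity))
  rw [mul_pow, mul_pow, Real.sq_sqrt (by positivity), Real.sq_sqrt (by positivity)]
  calc _ ≤ (T : ℝ) * ((G.actions i s).card * G.utilityRange i ^ 2) := h1.trans h2
    _ ≤ T * (G.maxActions i * G.utilityRange i ^ 2) := by gcongr
    _ = _ := by ring

/-- The regret bound of counterfactual regret minimization. -/
theorem IsCFRBR.sum_regret_le {G : EFGame A S} (hG : G.PerfectRecall) {i : Fin 2}
    [Fintype (S i)] {T : ℕ} (hT : 1 ≤ T) {π : ℕ → G.JointPolicy} (hπ : G.IsCFRBR i T π)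
    (σ : G.Policy i) :
    ∑ k ∈ Finset.Icc 1 T, (G.value i (Function.update (π k) i σ) - G.value i (π k)) ≤
      T * G.cfrbrBound i T := by
  have hex : ∀ s : S i, ∃ h, h ∈ G.stateHistories i s := fun s => by
    obtain ⟨h, hh, hn⟩ := G.state_nonempty i s
    exact ⟨h, G.mem_stateHistories.2 ⟨hh, hn⟩⟩
  choose h hh using hex
  have hΔ := G.utilityRange_nonneg i
  set B := G.utilityRange i * √(G.maxActions i) * √T with hB
  have hB0 : 0 ≤ B := by positivity
  have hown : ∀ k s, G.ownReach i (Function.update (π k) i σ) (h s) =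
      G.ownReach i (Function.update (π 1) i σ) (h s) := fun k s =>
    G.ownReach_congr (by simp) _
  have hIco : Finset.Icc 1 T = Finset.Ico 1 (T + 1) := by
    ext k
    simp
  calc _ = ∑ s, G.ownReach i (Function.update (π 1) i σ) (h s) *
        ∑ a, (σ s).1 a * G.cumRegret i π (T + 1) s a := by
        rw [Finset.sum_congr rfl fun k _ => hG.value_update_sub_value i (π k) σ h hh,
          Finset.sum_comm]
        refine Finset.sum_congr rfl fun s _ => ?_
        rw [Finset.sum_congr rfl fun k _ => by rw [hown k s], ← Finset.mul_sum, Finset.sum_comm]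
        simp only [cumRegret, hIco, Finset.mul_sum]
    _ ≤ ∑ _s : S i, B := by
        refine Finset.sum_le_sum fun s _ => ?_
        have h1 : ∑ a, (σ s).1 a * G.cumRegret i π (T + 1) s a ≤ B := by
          calc _ ≤ ∑ a, (σ s).1 a * B := Finset.sum_le_sum fun a _ =>
                mul_le_mul_of_nonneg_left (hπ.cumRegret_le hG s a) ((σ s).2.1 a)
            _ = B := by rw [← Finset.sum_mul, (σ s).2.2, one_mul]
        exact (mul_le_mul_of_nonneg_left h1 (G.ownReach_nonneg i _ _)).trans
          (mul_le_of_le_one_left hB0 (G.ownReach_le_one i _ _))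
    _ = _ := by
        have hT0 : (0 : ℝ) < T := by exact_mod_cast hT
        rw [Finset.sum_const, Finset.card_univ, nsmul_eq_mul, cfrbrBound, hB]
        field_simp
        rw [Real.sq_sqrt hT0.le]

/-! ### The average policy -/

open Classical in
/-- The average over `k ∈ I` of the policies `π k j`: at each information state, the actions are
mixed with weights proportional to `j`'s own probability of playing to the state (which can be
read off at any history of the state). At states that no `π k j` plays to, the value is
immaterial and `π 0 j` is used. -/
noncomputable def avgPolicy (G : EFGame A S) (j : Fin 2) (I : Finset ℕ)
    (π : ℕ → G.JointPolicy) : G.Policy j := fun s =>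
  let ρ : ℕ → ℝ := fun k => G.ownReach j (π k) (G.state_nonempty j s).choose
  if hρ : 0 < ∑ k ∈ I, ρ k then
    ⟨fun a => ∑ k ∈ I, (ρ k / ∑ l ∈ I, ρ l) * (π k j s).1 a, by
      refine ⟨fun a => Finset.sum_nonneg fun k _ => mul_nonneg
        (div_nonneg (G.ownReach_nonneg j _ _) hρ.le) ((π k j s).2.1 a), ?_⟩
      rw [Finset.sum_comm]
      simp only [← Finset.mul_sum, (π _ j s).2.2, mul_one]
      rw [← Finset.sum_div, div_self hρ.ne']⟩
  else π 0 j s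

theorem PerfectRecall.avgPolicy_apply {G : EFGame A S} (hG : G.PerfectRecall) {j : Fin 2}
    (I : Finset ℕ) (π : ℕ → G.JointPolicy) {s : S j} {h : List A}
    (hh : h ∈ G.stateHistories j s) (a : G.actions j s) :
    (∑ k ∈ I, G.ownReach j (π k) h) * (G.avgPolicy j I π s).1 a =
      ∑ k ∈ I, G.ownReach j (π k) h * (π k j s).1 a := by
  have hc := (G.state_nonempty j s).choose_spec
  have hρ : ∀ k, G.ownReach j (π k) (G.state_nonempty j s).choose = G.ownReach j (π k) h :=
    fun k => hG.ownReach_eq (π k) (G.mem_stateHistories.2 hc) hh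
  unfold avgPolicy
  simp only [hρ]
  split_ifs with hpos
  · simp only [Finset.mul_sum]
    refine Finset.sum_congr rfl fun k _ => ?_
    field_simp
  · have hnn : ∀ k ∈ I, 0 ≤ G.ownReach j (π k) h := fun k _ => G.ownReach_nonneg j _ _
    have h0 := le_antisymm (not_lt.1 hpos) (Finset.sum_nonneg hnn)
    rw [h0, zero_mul]
    refine (Finset.sum_eq_zero fun k hk => ?_).symm
    rw [(Finset.sum_eq_zero_iff_of_nonneg hnn).1 h0 k hk, zero_mul]

/-- The average policy is realization equivalent to mixing the policies uniformly. -/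
theorem PerfectRecall.card_mul_ownReach_avgPolicy {G : EFGame A S} (hG : G.PerfectRecall)
    {j : Fin 2} (I : Finset ℕ) (π : ℕ → G.JointPolicy) (τ : G.JointPolicy)
    (hτ : τ j = G.avgPolicy j I π) (h : List A) :
    h ∈ G.histories → I.card * G.ownReach j τ h = ∑ k ∈ I, G.ownReach j (π k) h := by
  induction h using List.reverseRecOn with
  | nil => simp [ownReach, experienceFrom]
  | append_singleton h a ih =>
    intro hm
    obtain ⟨hh, ha⟩ := (G.append_mem_iff h a).1 hm
    by_cases hn : ∃ s : S j, G.node h = .decision j s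
    · obtain ⟨s, hs⟩ := hn
      have ha' : a ∈ G.actions j s := by simpa [nextActions, hs] using ha
      have hstep : ∀ μ : G.JointPolicy,
          G.ownReach j μ (h ++ [a]) = G.ownReach j μ h * (μ j s).1 ⟨a, ha'⟩ := by
        intro μ
        rw [ownReach, G.experienceFrom_append_of_decision hs, ← G.actionProb_coe]
        simp [ownReach]
      simp only [hstep]
      rw [← mul_assoc, ih hh, hτ]
      exact hG.avgPolicy_apply I π (G.mem_stateHistories.2 ⟨hh, hs⟩) _
    · push Not at hn
      simp only [ownReach, G.experienceFrom_append_of_not_decision hn]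
      exact ih hh

theorem PerfectRecall.card_mul_value_avgPolicy {G : EFGame A S} (hG : G.PerfectRecall)
    (i j : Fin 2) (I : Finset ℕ) (π : ℕ → G.JointPolicy) (τ : G.JointPolicy) :
    I.card * G.value i (Function.update τ j (G.avgPolicy j I π)) =
      ∑ k ∈ I, G.value i (Function.update τ j (π k j)) := by
  simp only [value]
  rw [Finset.mul_sum, Finset.sum_comm]
  refine Finset.sum_congr rfl fun z hz => ?_
  have hm : z ∈ G.histories := (G.mem_terminals.1 hz).1
  have ho : ∀ β : G.Policy j, G.othersReach j (Function.update τ j β) z = G.othersReach j τ z :=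
    fun β => G.othersReach_congr (fun l hl => by simp [hl]) z
  simp only [G.reach_eq j, ho]
  rw [← mul_assoc, ← mul_assoc, hG.card_mul_ownReach_avgPolicy I π _ (by simp) z hm,
    Finset.sum_mul, Finset.sum_mul]
  refine Finset.sum_congr rfl fun k _ => ?_
  rw [G.ownReach_congr (π := Function.update τ j (π k j)) (π' := π k) (by simp)]

/-! ### The best iterate -/

theorem IsZeroSum.value_eq_neg {G : EFGame A S} (hG : G.IsZeroSum) {i j : Fin 2} (hij : j ≠ i)
    (π : G.JointPolicy) : G.value j π = - G.value i π := by
  simp only [value]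
  rw [← Finset.sum_neg_distrib]
  refine Finset.sum_congr rfl fun z hz => ?_
  have h0 := hG z hz
  have : G.utility j z = - G.utility i z := by
    fin_cases i <;> fin_cases j <;> simp at hij ⊢ <;> linarith
  rw [this, mul_neg]

/-- A best iterate, paired with the average of the opponent's best responses, is an
`ε`-Nash equilibrium. -/
theorem IsCFRBR.isNash_update_avgPolicy {G : EFGame A S} (hzero : G.IsZeroSum)
    (hrecall : G.PerfectRecall) {i j : Fin 2} (hij : j ≠ i) [Fintype (S i)] {T : ℕ} (hT : 1 ≤ T)
    {π : ℕ → G.JointPolicy} (hπ : G.IsCFRBR i T π) {t : ℕ} (ht : t ∈ Finset.Icc 1 T)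
    (hbest : ∀ k ∈ Finset.Icc 1 T, G.value i (π k) ≤ G.value i (π t)) :
    G.IsNash (G.cfrbrBound i T)
      (Function.update (π t) j (G.avgPolicy j (Finset.Icc 1 T) π)) := by
  set b := G.avgPolicy j (Finset.Icc 1 T) π with hb
  have hT0 : (0 : ℝ) < T := by exact_mod_cast hT
  have hother : ∀ l, l ≠ i → l = j := fun l hl => by omega
  have hmin : ∀ β : G.Policy j, G.value i (π t) ≤ G.value i (Function.update (π t) j β) := by
    intro β
    have := hπ.bestResponse t ht j hij β
    rw [hzero.value_eq_neg hij, hzero.value_eq_neg hij] at this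
    linarith
  have hmax : ∀ τ : G.JointPolicy,
      G.value i (Function.update τ j b) ≤ G.value i (π t) + G.cfrbrBound i T := by
    intro τ
    have h1 := hrecall.card_mul_value_avgPolicy i j (Finset.Icc 1 T) π τ
    have h2 := hπ.sum_regret_le hrecall hT (τ i)
    have h3 : ∀ k, Function.update τ j (π k j) = Function.update (π k) i (τ i) := by
      intro k
      funext l
      by_cases hl : l = i
      · subst hl
        simp [hij.symm]
      · obtain rfl := hother l hl
        simp [hl]
    have h4 : ∑ k ∈ Finset.Icc 1 T, G.value i (π k) ≤ T * G.value i (π t) := by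
      simpa using Finset.sum_le_card_nsmul _ _ _ hbest
    simp only [h3, Nat.card_Icc, Nat.add_sub_cancel] at h1
    rw [Finset.sum_sub_distrib, ← h1] at h2
    refine le_of_mul_le_mul_left ?_ hT0
    linarith
  intro l β
  by_cases hl : l = i
  · subst hl
    rw [Function.update_comm hij]
    linarith [hmin b, hmax (Function.update (π t) l β)]
  · obtain rfl := hother l hl
    rw [hzero.value_eq_neg hij, hzero.value_eq_neg hij, Function.update_idem]
    linarith [hmin β, hmax (π t)]

theorem cfrbrBound_nonneg (G : EFGame A S) (i : Fin 2) [Fintype (S i)] (T : ℕ) :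
    0 ≤ G.cfrbrBound i T := by
  have := G.utilityRange_nonneg i
  unfold cfrbrBound
  positivity

end EFGame

theorem mainTheorem3 {A : Type*} {S : Fin 2 → Type*} (G : EFGame A S)
    (hzero : G.IsZeroSum) (hrecall : G.PerfectRecall)
    (i : Fin 2) [Fintype (S i)] (T : ℕ) (hT : 1 ≤ T)
    (π : ℕ → G.JointPolicy) (hπ : G.IsCFRBR i T π) :
    (∃ t ∈ Finset.Icc 1 T, G.IsEquilibriumPolicy i (2 * G.cfrbrBound i T) (π t i)) ∧
    ∀ t ∈ Finset.Icc 1 T, (∀ k ∈ Finset.Icc 1 T, G.value i (π k) ≤ G.value i (π t)) →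
      G.IsEquilibriumPolicy i (2 * G.cfrbrBound i T) (π t i) := by
  have hbest : ∀ t ∈ Finset.Icc 1 T,
      (∀ k ∈ Finset.Icc 1 T, G.value i (π k) ≤ G.value i (π t)) →
      G.IsEquilibriumPolicy i (2 * G.cfrbrBound i T) (π t i) := by
    intro t ht hmax
    obtain ⟨j, hij⟩ := exists_ne i
    refine ⟨_, ?_, fun l β =>
      (hπ.isNash_update_avgPolicy hzero hrecall hij hT ht hmax l β).trans ?_⟩
    · simp [hij.symm]
    · linarith [G.cfrbrBound_nonneg i T]
  obtain ⟨t, ht, hmax⟩ := (Finset.Icc 1 T).exists_max_image (fun k => G.value i (π k))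
    ⟨1, Finset.mem_Icc.2 ⟨le_rfl, hT⟩⟩
  exact ⟨⟨t, ht, hbest t ht hmax⟩, hbest⟩
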